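/- A tree is a connected acyclic simple graph. An embedding of a tree $T$ into a tree $S$ is an injective map from the vertices of $T$ to the vertices of $S$ that preserves adjacency; an embedding of $T$ is an embedding of $T$ into itself. Two trees are siblings if each of them embeds into the other, and $Sib(T)$ denotes the number of isomorphism classes of trees that are siblings of $T$. A ray is a one-way infinite path. Two rays in $T$ are equivalent if their intersection is also a ray, and the ends of $T$ are the equivalence classes of its rays; an embedding $g$ of $T$ maps the end of a ray $R$ to the end of the ray $g(R)$. An embedding $g$ of $T$ is parabolic if there is no non-empty finite subtree $F$ of $T$ with $g(F)=F$ and $g$ fixes precisely one end of $T$. Theorem. Let $T$ be a locally finite tree (every vertex has finite degree). If $T$ has a parabolic embedding, then $Sib(T)=\infty$, that is, $T$ has infinitely many pairwise non-isomorphic siblings, unless $T$ is a ray. -/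

import Mathlib

namespace TreeSiblings

universe u v

variable {V : Type u} {W : Type v}

/-- An embedding between trees is an injective map of the vertices that preserves adjacency. -/
abbrev TreeEmb (T : SimpleGraph V) (S : SimpleGraph W) : Type (max u v) :=
  SimpleGraph.Copy T S

/-- The one-way infinite path `0 - 1 - 2 - ⋯`. -/
abbrev rayGraph : SimpleGraph ℕ := SimpleGraph.hasse ℕ

/-- A graph is a ray if it is isomorphic to the one-way infinite path. -/
def IsRay (T : SimpleGraph V) : Prop := Nonempty (T ≃g rayGraph)

/-- A ray in `T`, with its vertices listed from its starting vertex on. Its underlying subgraph is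
`R.toSubgraph`, which determines `R`. -/
abbrev Ray (T : SimpleGraph V) : Type u := SimpleGraph.Copy rayGraph T

/-- Two rays are equivalent if their intersection is also a ray. -/
def RayEquiv {T : SimpleGraph V} (R S : Ray T) : Prop :=
  ∃ P : Ray T, P.toSubgraph = R.toSubgraph ⊓ S.toSubgraph

section Equivalence

variable {T : SimpleGraph V}

theorem ray_adj (R : Ray T) (i : ℕ) : T.Adj (R i) (R (i + 1)) :=
  R.toHom.map_adj (by simp [SimpleGraph.hasse_adj])

theorem mem_ray_verts (R : Ray T) (x : V) : x ∈ R.toSubgraph.verts ↔ ∃ i, R i = x := by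
  simp [SimpleGraph.Copy.toSubgraph]

theorem ray_toSubgraph_adj (R : Ray T) (x y : V) : R.toSubgraph.Adj x y ↔
    ∃ i, (R i = x ∧ R (i + 1) = y) ∨ (R i = y ∧ R (i + 1) = x) := by
  simp only [SimpleGraph.Copy.toSubgraph, SimpleGraph.Subgraph.map_adj, Relation.map_apply,
    SimpleGraph.Subgraph.top_adj, SimpleGraph.hasse_adj, Order.covBy_iff_add_one_eq]
  constructor
  · rintro ⟨a, b, h | h, rfl, rfl⟩
    · exact ⟨a, Or.inl ⟨rfl, by rw [h]; rfl⟩⟩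
    · exact ⟨b, Or.inr ⟨rfl, by rw [h]; rfl⟩⟩
  · rintro ⟨i, ⟨rfl, rfl⟩ | ⟨rfl, rfl⟩⟩
    · exact ⟨i, i + 1, Or.inl rfl, rfl, rfl⟩
    · exact ⟨i + 1, i, Or.inr rfl, rfl, rfl⟩

/-- The segment of a ray between two of its vertices, as a path. -/
theorem ray_segment (R : Ray T) (a n : ℕ) : ∃ p : T.Path (R a) (R (a + n)),
    p.1.length = n ∧ ∀ j ≤ n, p.1.getVert j = R (a + j) := by
  induction n with
  | zero => exact ⟨⟨.nil, .nil⟩, rfl, fun j hj => by simp [Nat.le_zero.mp hj]⟩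
  | succ n ih =>
    obtain ⟨p, hl, hp⟩ := ih
    have hmem : R (a + (n + 1)) ∉ p.1.support := by
      intro h
      obtain ⟨j, hj, hjl⟩ := SimpleGraph.Walk.mem_support_iff_exists_getVert.mp h
      rw [hp j (by omega)] at hj
      have := R.injective hj
      omega
    refine ⟨⟨p.1.concat (ray_adj R (a + n)), p.2.concat hmem _⟩, by simp [hl], fun j hj => ?_⟩
    rcases Nat.lt_or_ge n j with h | h
    · obtain rfl : j = n + 1 := by omega
      have := (p.1.concat (ray_adj R (a + n))).getVert_length
      rwa [SimpleGraph.Walk.length_concat, hl] at this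
    · have : (p.1.concat (ray_adj R (a + n))).getVert j = p.1.getVert j := by
        rw [SimpleGraph.Walk.concat_eq_append, SimpleGraph.Walk.getVert_append]
        split_ifs with h'
        · rfl
        · obtain rfl : j = n := by omega
          rw [hl, Nat.sub_self, SimpleGraph.Walk.getVert_zero, hp j le_rfl]
      rw [← hp j h]; exact this

/-- In an acyclic graph, two rays with a common vertex and a common later vertex agree between. -/
theorem ray_agree (hT : T.IsAcyclic) (R S : Ray T) {a b n m : ℕ} (h₀ : R a = S b)
    (h₁ : R (a + n) = S (b + m)) : ∀ j ≤ n, R (a + j) = S (b + j) := by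
  obtain ⟨p, hpl, hp⟩ := ray_segment R a n
  obtain ⟨q, hql, hq⟩ := ray_segment S b m
  have key : p.1 = q.1.copy h₀.symm h₁.symm := by
    have := (hT.subsingleton_path _ _).elim p ⟨q.1.copy h₀.symm h₁.symm, by simp⟩
    exact congrArg Subtype.val this
  have hnm : n = m := by rw [← hpl, ← hql, key]; simp
  intro j hj
  rw [← hp j hj, ← hq j (by omega), key]; simp

theorem ray_tail_of_toSubgraph_le (P R : Ray T) (h : P.toSubgraph ≤ R.toSubgraph) :
    ∃ a, ∀ k, P k = R (a + k) := by
  have hi : ∀ k, ∃ i, R i = P k := fun k =>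
    (mem_ray_verts R _).mp (h.1 ((mem_ray_verts P _).mpr ⟨k, rfl⟩))
  choose i hi using hi
  have hinj : ∀ k l, i k = i l → k = l := fun k l e => P.injective (by
    change P k = P l
    rw [← hi, ← hi, e])
  have step : ∀ k, i (k + 1) = i k + 1 ∨ i k = i (k + 1) + 1 := by
    intro k
    obtain ⟨l, ⟨e₁, e₂⟩ | ⟨e₁, e₂⟩⟩ := (ray_toSubgraph_adj R _ _).mp
      (h.2 ((ray_toSubgraph_adj P (P k) (P (k + 1))).mpr ⟨k, Or.inl ⟨rfl, rfl⟩⟩))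
    · rw [← hi] at e₁ e₂
      have := R.injective e₁
      have := R.injective e₂
      omega
    · rw [← hi] at e₁ e₂
      have := R.injective e₁
      have := R.injective e₂
      omega
  have up : ∀ k, i (k + 1) = i k + 1 := by
    intro k
    refine (step k).resolve_right fun hd => ?_
    have down : ∀ j, i (k + j) = i (k + j + 1) + 1 := by
      intro j
      induction j with
      | zero => exact hd
      | succ j ih =>
        refine (step (k + j + 1)).resolve_left fun hu => ?_
        have := hinj (k + j) (k + j + 1 + 1) (by omega)
        omega
    have : ∀ j, i (k + j) + j = i k := by
      intro j
      induction j with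
      | zero => rfl
      | succ j ih => have := down j; change i (k + j + 1) + (j + 1) = i k; omega
    have := this (i k + 1)
    omega
  have : ∀ k, i k = i 0 + k := by
    intro k
    induction k with
    | zero => rfl
    | succ k ih => rw [up, ih]; omega
  exact ⟨i 0, fun k => by rw [← this, hi]⟩

theorem rayEquiv_iff (hT : T.IsAcyclic) (R S : Ray T) :
    RayEquiv R S ↔ ∃ m n, ∀ k, R (m + k) = S (n + k) := by
  classical
  constructor
  · rintro ⟨P, hP⟩
    obtain ⟨a, ha⟩ := ray_tail_of_toSubgraph_le P R (hP ▸ inf_le_left)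
    obtain ⟨b, hb⟩ := ray_tail_of_toSubgraph_le P S (hP ▸ inf_le_right)
    exact ⟨a, b, fun k => by rw [← ha, hb]⟩
  · rintro ⟨m, n, h⟩
    have hex : ∃ a b, R a = S b := ⟨m, n, by simpa using h 0⟩
    let a := Nat.find hex
    obtain ⟨b, hab⟩ : ∃ b, R a = S b := Nat.find_spec hex
    have hmin : ∀ i j, R i = S j → a ≤ i := fun i j e => Nat.find_min' hex ⟨j, e⟩
    have agree : ∀ j, R (a + j) = S (b + j) := by
      intro j
      refine ray_agree hT R S (n := m + (a + b + j) - a) (m := n + (a + b + j) - b) hab ?_ j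
        (by omega)
      have := h (a + b + j)
      rwa [show a + (m + (a + b + j) - a) = m + (a + b + j) by omega,
        show b + (n + (a + b + j) - b) = n + (a + b + j) by omega]
    let P : Ray T := ⟨⟨fun k => R (a + k), by
      intro x y hxy
      apply R.toHom.map_adj
      simp only [SimpleGraph.hasse_adj, Order.covBy_iff_add_one_eq] at hxy ⊢
      omega⟩, fun x y e => by
        have := R.injective e
        omega⟩
    have hPk : ∀ k, P k = R (a + k) := fun _ => rfl
    refine ⟨P, SimpleGraph.Subgraph.ext ?_ ?_⟩
    · ext x
      rw [SimpleGraph.Subgraph.verts_inf, Set.mem_inter_iff, mem_ray_verts, mem_ray_verts,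
        mem_ray_verts]
      constructor
      · rintro ⟨k, rfl⟩
        exact ⟨⟨a + k, rfl⟩, ⟨b + k, (agree k).symm⟩⟩
      · rintro ⟨⟨i, rfl⟩, ⟨j, e⟩⟩
        have := hmin i j e.symm
        exact ⟨i - a, by rw [hPk]; congr 1; omega⟩
    · ext x y
      rw [SimpleGraph.Subgraph.inf_adj, ray_toSubgraph_adj, ray_toSubgraph_adj,
        ray_toSubgraph_adj]
      constructor
      · rintro ⟨k, ⟨rfl, rfl⟩ | ⟨rfl, rfl⟩⟩
        · exact ⟨⟨a + k, Or.inl ⟨rfl, rfl⟩⟩, ⟨b + k, Or.inl ⟨(agree k).symm, (agree (k + 1)).symm⟩⟩⟩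
        · exact ⟨⟨a + k, Or.inr ⟨rfl, rfl⟩⟩, ⟨b + k, Or.inr ⟨(agree k).symm, (agree (k + 1)).symm⟩⟩⟩
      · rintro ⟨⟨i, hi⟩, ⟨j, hj⟩⟩
        have hai : a ≤ i := by
          rcases hi with ⟨e, e'⟩ | ⟨e, e'⟩ <;> rcases hj with ⟨f, f'⟩ | ⟨f, f'⟩
          · exact hmin i j (e.trans f.symm)
          · exact hmin i (j + 1) (e.trans f'.symm)
          · exact hmin i (j + 1) (e.trans f'.symm)
          · exact hmin i j (e.trans f.symm)
        refine ⟨i - a, ?_⟩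
        rwa [hPk, hPk, show a + (i - a) = i by omega, show a + (i - a + 1) = i + 1 by omega]

/-- In an acyclic graph, equivalence of rays is indeed an equivalence relation. -/
theorem rayEquiv_equivalence (hT : T.IsAcyclic) : Equivalence (RayEquiv (T := T)) where
  refl R := ⟨R, (inf_idem _).symm⟩
  symm := fun ⟨P, hP⟩ => ⟨P, hP.trans (inf_comm _ _)⟩
  trans {R S Q} h₁ h₂ := by
    obtain ⟨a, b, h₁⟩ := (rayEquiv_iff hT R S).mp h₁
    obtain ⟨c, d, h₂⟩ := (rayEquiv_iff hT S Q).mp h₂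
    refine (rayEquiv_iff hT R Q).mpr ⟨a + c, d + b, fun k => ?_⟩
    rw [add_assoc, h₁, add_assoc d b k, ← h₂]
    congr 1
    omega

end Equivalence

/-- An embedding maps equivalent rays to equivalent rays. -/
theorem RayEquiv.comp {T : SimpleGraph V} {R S : Ray T} (h : RayEquiv R S) (g : TreeEmb T T) :
    RayEquiv (g.comp R) (g.comp S) := by
  obtain ⟨P, hP⟩ := h
  have hmap : ∀ Q : Ray T, (g.comp Q).toSubgraph = Q.toSubgraph.map g.toHom := fun Q =>
    SimpleGraph.Subgraph.map_comp _ _ _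
  refine ⟨g.comp P, ?_⟩
  rw [hmap, hmap, hmap, hP]
  have hg : ∀ x y, g.toHom x = g.toHom y → x = y := fun x y e => g.injective e
  refine SimpleGraph.Subgraph.ext ?_ ?_
  · simp only [SimpleGraph.Subgraph.map_verts, SimpleGraph.Subgraph.verts_inf]
    exact Set.image_inter g.injective
  · ext x y
    simp only [SimpleGraph.Subgraph.map_adj, SimpleGraph.Subgraph.inf_adj, Relation.map_apply]
    constructor
    · rintro ⟨u, w, ⟨h₁, h₂⟩, rfl, rfl⟩
      exact ⟨⟨u, w, h₁, rfl, rfl⟩, ⟨u, w, h₂, rfl, rfl⟩⟩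
    · rintro ⟨⟨u, w, h₁, rfl, rfl⟩, ⟨u', w', h₂, e, e'⟩⟩
      obtain rfl := hg _ _ e
      obtain rfl := hg _ _ e'
      exact ⟨u', w', ⟨h₁, h₂⟩, rfl, rfl⟩

/-- The ends of a tree `T`: the equivalence classes of its rays. (`RayEquiv` is an equivalence
relation by `rayEquiv_equivalence`, whenever `T` is a tree.) -/
def TreeEnd (T : SimpleGraph V) : Type u := Quot (RayEquiv (T := T))

/-- The action of an embedding `g` on the ends: the end of the ray `R` goes to that of `g(R)`. -/
def TreeEnd.map {T : SimpleGraph V} (g : TreeEmb T T) : TreeEnd T → TreeEnd T :=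
  Quot.map (fun R : Ray T => g.comp R) fun _ _ h => h.comp g

/-- An embedding is elliptic if it fixes (setwise) a non-empty finite subtree. A graph that
`IsTree` is connected and in particular non-empty. -/
def IsElliptic {T : SimpleGraph V} (g : TreeEmb T T) : Prop :=
  ∃ F : T.Subgraph, F.coe.IsTree ∧ F.verts.Finite ∧ F.map g.toHom = F

/-- An embedding is parabolic if it is not elliptic and fixes precisely one end. -/
def IsParabolic {T : SimpleGraph V} (g : TreeEmb T T) : Prop :=
  ¬ IsElliptic g ∧ ∃! η : TreeEnd T, TreeEnd.map g η = η

/-- Two trees are siblings (equimorphic) if each of them embeds in the other. -/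
def AreSiblings (T : SimpleGraph V) (S : SimpleGraph W) : Prop :=
  Nonempty (TreeEmb T S) ∧ Nonempty (TreeEmb S T)

/-- The trees that are siblings of `T`, on arbitrary vertex types in the universe of `T`. Every
sibling of `T`, in whatever universe, is isomorphic to one of these, namely to a subtree of `T`. -/
structure Sibling (T : SimpleGraph V) : Type (u + 1) where
  /-- the vertices of the sibling -/
  Vert : Type u
  /-- the sibling itself -/
  graph : SimpleGraph Vert
  isTree : graph.IsTree
  areSiblings : AreSiblings T graph

/-- Isomorphism of siblings of `T`. -/
def siblingSetoid (T : SimpleGraph V) : Setoid (Sibling T) where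
  r S₁ S₂ := Nonempty (S₁.graph ≃g S₂.graph)
  iseqv :=
    { refl := fun _ => ⟨SimpleGraph.Iso.refl⟩
      symm := fun ⟨e⟩ => ⟨e.symm⟩
      trans := fun ⟨e⟩ ⟨e'⟩ => ⟨e.trans e'⟩ }

/-- The sibling number: the number of isomorphism classes of siblings of `T`. -/
def sib (T : SimpleGraph V) : Cardinal.{u + 1} := Cardinal.mk (Quotient (siblingSetoid T))

end TreeSiblings

/-!
A parabolic embedding `g` of the tree `T` fixes an end, and each vertex has a *parent*, its
neighbour in the direction of that end. With the parent map `π` the tree becomes a functional graph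
(`ParentMap`), subtrees that contain a ray `x` to the fixed end are sets closed under `π`, and
embeddings that preserve the end are those that commute with `π`. Such is `g`, which moves the ray
forward, `g (x i) = x (i + k)` with `k > 0`, and the iterates of `g` leave the descendants of every
vertex `x m`, since otherwise `g` would fix a second end (`IsParabolic.exists_translated_ray`,
`ParentMap.false_of_descending`). Hence every subtree of `T` that contains all vertices not below
some `x m` is a sibling of `T`. As `T` is not a ray, the ray `x` has branches arbitrarily far out
(`ParentMap.isRay_of_injective`, `ParentMap.exists_branch`). There are two cases.

If all self-embeddings of `T` commute with `π`, cut away everything that hangs off `x 0, …, x m`,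
which leaves a bare path of `m` edges, up to the leaf `x 0`, below `x m`. An isomorphism between two
of these trees commutes with `π` as well, and so preserves the numbers of vertices in each
generation below the vertices of the ray, up to a shift along the ray. The sizes of the branches at
the ray only grow under a translation by `k`, so that either they are eventually periodic, or they
do not eventually agree with any non-trivial shift of themselves (`exists_tail_rigid`). In either
case equal branches can be subtracted down to the place where the bare path of one of the two trees
begins, and the comparison there shows that the trees were trimmed at the same place
(`ParentMap.generationCount_ne`). So infinitely many siblings
arise.

If a self-embedding does not commute with `π`, then it turns a tail of the ray upside down
(`ParentMap.exists_image_subset_descendants`), and `T` embeds below some vertex `x i` of the ray.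
All branches beyond `x i` are then dispensable, and their removal yields a chain of siblings,
strictly increasing along `ℝ`. All of them contain `x 0`. Two members of the chain are not
isomorphic by an isomorphism that fixes `x 0`, because an embedding of a connected locally finite
graph into itself that fixes a vertex is surjective (`surjective_of_fixed`). As a tree isomorphic to
uncountably many members of the chain would have uncountably many vertices, there are infinitely
many siblings (`ParentMap.infinite_siblings_of_subset_descendants`).
-/

namespace TreeSiblings

universe u v

open Function

variable {V : Type u} {W : Type v}

/-! ### Trees seen from an end: the parent map -/

/-- `ParentMap T π x` presents the tree `T` as seen from the end of the ray `x 0, x 1, …`: the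
vertex `π v` (the parent of `v`) is the neighbour of `v` in the direction of that end, every other
neighbour of `v` is a child of `v`, and all ancestor lines run into the ray. -/
structure ParentMap (T : SimpleGraph V) (π : V → V) (x : ℕ → V) : Prop where
  adj_iff : ∀ v w, T.Adj v w ↔ π v = w ∨ π w = v
  map_ray : ∀ i, π (x i) = x (i + 1)
  ray_injective : Injective x
  merge : ∀ v, ∃ a i, π^[a] v = x i

/-- The descendants of `v` with respect to a parent map, `v` included. -/
def descendants (π : V → V) (v : V) : Set V := {w | ∃ n, π^[n] w = v}

namespace ParentMap

variable {T : SimpleGraph V} {π : V → V} {x : ℕ → V}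
variable {S : SimpleGraph W} {ρ : W → W} {y : ℕ → W}

theorem iterate_ray (h : ParentMap T π x) (a i : ℕ) : π^[a] (x i) = x (i + a) := by
  induction a with
  | zero => rfl
  | succ a ih => rw [iterate_succ_apply', ih, h.map_ray, add_assoc]

theorem shift (h : ParentMap T π x) (n : ℕ) : ParentMap T π fun i => x (n + i) where
  adj_iff := h.adj_iff
  map_ray i := h.map_ray _
  ray_injective i j e := by have := h.ray_injective e; omega
  merge v := by
    obtain ⟨a, i, e⟩ := h.merge v
    exact ⟨n + a, i, by rw [iterate_add_apply, e, h.iterate_ray, add_comm]⟩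

theorem iterate_succ_ne (h : ParentMap T π x) (p : ℕ) (v : V) : π^[p + 1] v ≠ v := by
  intro e
  obtain ⟨a, i, ha⟩ := h.merge v
  have h₁ : π^[a] (π^[p + 1] v) = x (i + (p + 1)) := by
    rw [← iterate_add_apply, add_comm, iterate_add_apply, ha, h.iterate_ray]
  rw [e, ha] at h₁
  have := h.ray_injective h₁
  omega

theorem adj_parent (h : ParentMap T π x) (v : V) : T.Adj v (π v) := (h.adj_iff _ _).2 (.inl rfl)

theorem connected (h : ParentMap T π x) : T.Connected := by
  have hup : ∀ a v, T.Reachable v (π^[a] v) := fun a => by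
    induction a with
    | zero => exact fun v => .rfl
    | succ a ih => exact fun v => (h.adj_parent v).reachable.trans (ih (π v))
  have h₀ : ∀ v, T.Reachable v (x 0) := fun v => by
    obtain ⟨a, i, e⟩ := h.merge v
    have h₁ := hup a v
    have h₂ := hup i (x 0)
    rw [e] at h₁
    rw [h.iterate_ray, zero_add] at h₂
    exact h₁.trans h₂.symm
  have : Nonempty V := ⟨x 0⟩
  exact ⟨fun v w => (h₀ v).trans (h₀ w).symm⟩

/-- If an embedding does not commute with taking parents at `v`, then it turns the edge from `v`
to its parent upside down. -/
theorem reverse_of_not_commute (h : ParentMap T π x) (h' : ParentMap S ρ y) (φ : TreeEmb T S)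
    {v : V} (hv : φ (π v) ≠ ρ (φ v)) : ρ (φ (π v)) = φ v :=
  ((h'.adj_iff _ _).1 (φ.toHom.map_adj (h.adj_parent v))).resolve_left (Ne.symm hv)

/-- Commuting with the parent maps is inherited by children: an edge that is turned upside down
would be folded onto the edge above it. -/
theorem commute_of_commute_parent (h : ParentMap T π x) (h' : ParentMap S ρ y) (φ : TreeEmb T S)
    {v : V} (hv : φ (π (π v)) = ρ (φ (π v))) : φ (π v) = ρ (φ v) := by
  by_contra hne
  have := φ.injective (hv.trans (h.reverse_of_not_commute h' φ hne))
  exact h.iterate_succ_ne 1 v this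

theorem commute_of_commute_iterate (h : ParentMap T π x) (h' : ParentMap S ρ y) (φ : TreeEmb T S)
    (a : ℕ) : ∀ v, φ (π (π^[a] v)) = ρ (φ (π^[a] v)) → φ (π v) = ρ (φ v) := by
  induction a with
  | zero => exact fun v hv => hv
  | succ a ih => exact fun v hv => h.commute_of_commute_parent h' φ (ih (π v) hv)

/-- An embedding that commutes with the parent maps far out on the ray does so everywhere. -/
theorem commute_of_eventually (h : ParentMap T π x) (h' : ParentMap S ρ y) (φ : TreeEmb T S)
    {N : ℕ} (hN : ∀ i, N ≤ i → φ (π (x i)) = ρ (φ (x i))) (v : V) : φ (π v) = ρ (φ v) := by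
  obtain ⟨a, i, e⟩ := h.merge v
  refine h.commute_of_commute_iterate h' φ (N + a) v ?_
  rw [iterate_add_apply, e, h.iterate_ray]
  exact hN _ (Nat.le_add_left _ _)

theorem finite_iterate_preimage (hfin : ∀ v, {w | π w = v}.Finite) (r : ℕ) :
    ∀ v, {w | π^[r] w = v}.Finite := by
  induction r with
  | zero => exact fun v => Set.finite_singleton v
  | succ r ih =>
    intro v
    refine ((hfin v).biUnion fun w _ => ih w).subset fun w hw => ?_
    rw [Set.mem_ofPred_eq, iterate_succ_apply'] at hw
    exact Set.mem_biUnion hw rfl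

theorem countable (h : ParentMap T π x) (hfin : ∀ v, {w | π w = v}.Finite) : Countable V := by
  rw [← Set.countable_univ_iff]
  refine (Set.countable_iUnion fun a : ℕ => Set.countable_iUnion fun i : ℕ =>
    (finite_iterate_preimage hfin a (x i)).countable).mono fun v _ => ?_
  simpa using h.merge v

theorem finite_children [T.LocallyFinite] (h : ParentMap T π x) (v : V) : {w | π w = v}.Finite :=
  (Set.toFinite (T.neighborSet v)).subset fun _ hw => (h.adj_iff _ _).2 (.inr hw)

/-- A set of vertices that contains the ray and is closed under taking parents induces a tree with
the restricted parent map. -/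
theorem restrict (h : ParentMap T π x) {U : Set V} (hU : Set.MapsTo π U U) (hx : ∀ i, x i ∈ U) :
    ParentMap (T.induce U) (hU.restrict π U U) fun i => ⟨x i, hx i⟩ where
  adj_iff v w := by simp [h.adj_iff, Subtype.ext_iff]
  map_ray i := Subtype.ext (h.map_ray i)
  ray_injective i j e := h.ray_injective (congrArg Subtype.val e)
  merge v := by
    obtain ⟨a, i, e⟩ := h.merge v
    exact ⟨a, i, Subtype.ext (by rw [hU.iterate_restrict]; exact e)⟩

end ParentMap

/-! ### Siblings inside a tree -/

/-- A connected part of the tree `T` that contains a copy of `T` is a sibling of `T`. -/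
def siblingOfInduce {T : SimpleGraph V} (hT : T.IsTree) (U : Set V)
    (hU : (T.induce U).Connected) (e : TreeEmb T T) (he : ∀ v, e v ∈ U) : Sibling T where
  Vert := U
  graph := T.induce U
  isTree := ⟨hU, hT.isAcyclic.induce U⟩
  areSiblings :=
    ⟨⟨⟨⟨fun v => ⟨e v, he v⟩, fun hvw => e.toHom.map_adj hvw⟩,
      fun _ _ hvw => e.injective (congrArg Subtype.val hvw)⟩⟩, ⟨SimpleGraph.Copy.induce T U⟩⟩

/-- A connected locally finite graph is rigid over each of its vertices: an embedding that fixes a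
vertex permutes the finitely many endpoints of walks of a given length from that vertex. -/
theorem surjective_of_fixed {G : SimpleGraph V} (hc : G.Preconnected)
    (hfin : ∀ v, (G.neighborSet v).Finite) (φ : TreeEmb G G) {v : V} (hv : φ v = v) :
    Surjective φ := by
  have hA : ∀ r v, {w | ∃ p : G.Walk v w, p.length = r}.Finite := by
    intro r
    induction r with
    | zero =>
      refine fun v => (Set.finite_singleton v).subset ?_
      rintro w ⟨p, hp⟩
      exact (SimpleGraph.Walk.eq_of_length_eq_zero hp).symm
    | succ r ih =>
      refine fun v => ((hfin v).biUnion fun w _ => ih w).subset ?_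
      rintro w ⟨p, hp⟩
      cases p with
      | nil => simp at hp
      | cons hadj p => exact Set.mem_biUnion hadj ⟨p, by simpa using hp⟩
  intro w
  obtain ⟨p⟩ := hc v w
  have hmaps : Set.MapsTo φ {w | ∃ q : G.Walk v w, q.length = p.length}
      {w | ∃ q : G.Walk v w, q.length = p.length} := by
    rintro z ⟨q, hq⟩
    exact ⟨(q.map φ.toHom).copy hv rfl, by simpa using hq⟩
  obtain ⟨z, -, hz⟩ := ((hA _ v).injOn_iff_bijOn_of_mapsTo hmaps).1 φ.injective.injOn |>.surjOn
    ⟨p, rfl⟩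
  exact ⟨z, hz⟩

/-! ### Trimming the branches at an initial segment of the ray -/

/-- The tree with everything below `x m` removed except for the ray itself: what hangs off
`x 0, …, x m` is cut away, so that these vertices form a bare path that ends in the leaf `x 0`. -/
def trimmed (π : V → V) (x : ℕ → V) (m : ℕ) : Set V := Set.range x ∪ (descendants π (x m))ᶜ

/-- The number of vertices of `U` that lie exactly `r` generations below `x i`. -/
noncomputable def generationCount (π : V → V) (x : ℕ → V) (U : Set V) (i r : ℕ) : ℕ :=
  {w | w ∈ U ∧ π^[r] w = x i}.ncard

/-- The number of vertices that lie exactly `r + 1` generations below `x (i + 1)` and do not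
descend from `x i`. -/
noncomputable def branchCount (π : V → V) (x : ℕ → V) (i r : ℕ) : ℕ :=
  {w | π^[r + 1] w = x (i + 1) ∧ π^[r] w ≠ x i}.ncard

namespace ParentMap

variable {T : SimpleGraph V} {π : V → V} {x : ℕ → V}

theorem not_mem_descendants_parent {v w : V} (hw : w ∉ descendants π v) :
    π w ∉ descendants π v := fun ⟨n, hn⟩ => hw ⟨n + 1, hn⟩

theorem mapsTo_trimmed (h : ParentMap T π x) (m : ℕ) :
    Set.MapsTo π (trimmed π x m) (trimmed π x m) := by
  rintro v (⟨i, rfl⟩ | hv)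
  · exact .inl ⟨i + 1, (h.map_ray i).symm⟩
  · exact .inr (not_mem_descendants_parent hv)

theorem ray_mem_trimmed (m i : ℕ) : x i ∈ trimmed π x m := .inl ⟨i, rfl⟩

theorem child_not_mem_descendants (h : ParentMap T π x) {m : ℕ} {c : V} (hc : π c = x (m + 1))
    (hne : c ≠ x m) : c ∉ descendants π (x m) := by
  rintro ⟨_ | a, ha⟩
  · exact hne ha
  · rw [iterate_succ_apply, hc, h.iterate_ray] at ha
    have := h.ray_injective ha
    omega

/-- Below `x m` the trimmed tree is a path with one vertex in each of the generations `0, …, m`. -/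
theorem generationCount_trimmed_self (h : ParentMap T π x) (m r : ℕ) :
    generationCount π x (trimmed π x m) m r = if r ≤ m then 1 else 0 := by
  have hset : ∀ w, (w ∈ trimmed π x m ∧ π^[r] w = x m) ↔ ∃ j, j + r = m ∧ x j = w := by
    intro w
    constructor
    · rintro ⟨⟨j, rfl⟩ | hw, e⟩
      · rw [h.iterate_ray] at e
        exact ⟨j, h.ray_injective e, rfl⟩
      · exact absurd ⟨r, e⟩ hw
    · rintro ⟨j, hj, rfl⟩
      exact ⟨ray_mem_trimmed m j, by rw [h.iterate_ray, hj]⟩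
  unfold generationCount
  split_ifs with hr
  · rw [Set.ncard_eq_one]
    refine ⟨x (m - r), Set.ext fun w => (hset w).trans ?_⟩
    constructor
    · rintro ⟨j, hj, rfl⟩
      rw [Set.mem_singleton_iff, ← hj, Nat.add_sub_cancel]
    · rintro rfl
      exact ⟨m - r, by omega, rfl⟩
  · have : {w | w ∈ trimmed π x m ∧ π^[r] w = x m} = ∅ := by
      refine Set.eq_empty_of_forall_notMem fun w hw => ?_
      obtain ⟨j, hj, -⟩ := (hset w).1 hw
      omega
    rw [this, Set.ncard_empty]

/-- Above the trimmed part, a generation below `x (i + 1)` splits into the vertices of the branch at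
`x (i + 1)` and the preceding generation below `x i`. -/
theorem generationCount_trimmed_succ (h : ParentMap T π x) (hfin : ∀ v, {w | π w = v}.Finite)
    {m i : ℕ} (hi : m ≤ i) (r : ℕ) :
    generationCount π x (trimmed π x m) (i + 1) (r + 1) =
      branchCount π x i r + generationCount π x (trimmed π x m) i r := by
  have hset : {w | w ∈ trimmed π x m ∧ π^[r + 1] w = x (i + 1)} =
      {w | π^[r + 1] w = x (i + 1) ∧ π^[r] w ≠ x i} ∪
        {w | w ∈ trimmed π x m ∧ π^[r] w = x i} := by
    ext w
    constructor
    · rintro ⟨hw, e⟩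
      by_cases hwi : π^[r] w = x i
      · exact .inr ⟨hw, hwi⟩
      · exact .inl ⟨e, hwi⟩
    · rintro (⟨e, hwi⟩ | ⟨hw, hwi⟩)
      · refine ⟨.inr ?_, e⟩
        rintro ⟨a, ha⟩
        rcases Nat.lt_or_ge r a with hr | hr
        · obtain ⟨b, rfl⟩ := Nat.exists_eq_add_of_lt hr
          rw [show r + b + 1 = b + (r + 1) by omega, iterate_add_apply, e, h.iterate_ray] at ha
          have := h.ray_injective ha
          omega
        · obtain ⟨b, rfl⟩ := Nat.exists_eq_add_of_le' hr
          rw [iterate_add_apply, ha, h.iterate_ray] at hwi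
          rw [iterate_succ_apply', iterate_add_apply, ha, h.iterate_ray, h.map_ray] at e
          have := h.ray_injective e
          exact hwi (congrArg x (by omega))
      · exact ⟨hw, by rw [iterate_succ_apply', hwi, h.map_ray]⟩
  unfold generationCount branchCount
  rw [hset, Set.ncard_union_eq (Set.disjoint_left.2 fun w hw hw' => hw.2 hw'.2)
    ((finite_iterate_preimage hfin (r + 1) (x (i + 1))).subset fun w hw => hw.1)
    ((finite_iterate_preimage hfin r (x i)).subset fun w hw => hw.2)]

/-- Beyond the bare path the ray branches, so that some generation has more than one vertex. -/
theorem two_le_generationCount (h : ParentMap T π x) (hfin : ∀ v, {w | π w = v}.Finite) {m : ℕ}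
    {c : V} (hc : π c = x (m + 1)) (hne : c ≠ x m) (b : ℕ) :
    2 ≤ generationCount π x (trimmed π x m) (m + 1 + b) (b + 1) := by
  have hsub : ({c, x m} : Set V) ⊆
      {w | w ∈ trimmed π x m ∧ π^[b + 1] w = x (m + 1 + b)} := by
    rintro w (rfl | rfl)
    · exact ⟨.inr (h.child_not_mem_descendants hc hne), by
        rw [iterate_succ_apply, hc, h.iterate_ray]⟩
    · exact ⟨ray_mem_trimmed m m, by rw [h.iterate_ray]; congr 1; omega⟩
  rw [← Set.ncard_pair hne]
  exact Set.ncard_le_ncard hsub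
    ((finite_iterate_preimage hfin _ _).subset fun w hw => hw.2)

/-- The generation counts of two distinct trimmed trees never agree after a shift along the ray, as
soon as the branches agree under that shift. Removing equal branches reduces the comparison to a
place where one tree is a bare path and the other is not, or is a bare path of another length. -/
theorem generationCount_ne (h : ParentMap T π x) (hfin : ∀ v, {w | π w = v}.Finite) {m m' i : ℕ}
    (hm : m ≠ m') (hi : m ≤ i) {c : V} (hc : π c = x (m + 1)) (hne : c ≠ x m)
    (hb : ∀ j r, branchCount π x (i + j) r = branchCount π x (m' + j) r) (J : ℕ)
    (hJ : ∀ r, generationCount π x (trimmed π x m) (i + J) r =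
      generationCount π x (trimmed π x m') (m' + J) r) : False := by
  induction J with
  | zero =>
    rcases hi.eq_or_lt with rfl | hlt
    · simp only [add_zero, h.generationCount_trimmed_self] at hJ
      have h₁ := hJ m
      have h₂ := hJ m'
      simp only [le_refl, if_true] at h₁ h₂
      split_ifs at h₁ h₂
      omega
    · obtain ⟨b, rfl⟩ := Nat.exists_eq_add_of_le (Nat.succ_le_of_lt hlt)
      have h₁ := h.two_le_generationCount hfin hc hne b
      have h₂ := hJ (b + 1)
      rw [add_zero, add_zero, h.generationCount_trimmed_self] at h₂
      rw [Nat.succ_eq_add_one] at h₂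
      split_ifs at h₂ <;> omega
  | succ J ih =>
    refine ih fun r => ?_
    have := hJ (r + 1)
    rw [← add_assoc, ← add_assoc, h.generationCount_trimmed_succ hfin (by omega),
      h.generationCount_trimmed_succ hfin (by omega), hb] at this
    omega

/-- The branches grow along an embedding that moves the ray into itself. -/
theorem branchCount_le (hfin : ∀ v, {w | π w = v}.Finite) {g : TreeEmb T T}
    (hg : ∀ v, g (π v) = π (g v)) {k : ℕ} (hk : ∀ i, g (x i) = x (i + k)) (i r : ℕ) :
    branchCount π x i r ≤ branchCount π x (i + k) r := by
  have hit : ∀ n v, g (π^[n] v) = π^[n] (g v) := fun n v =>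
    (Function.Semiconj.iterate_right (f := g) (ga := π) (gb := π) hg n) v
  refine Set.ncard_le_ncard_of_injOn g ?_ g.injective.injOn
    ((finite_iterate_preimage hfin _ _).subset fun w hw => hw.1)
  rintro w ⟨hw, hne⟩
  refine ⟨?_, fun e => hne ?_⟩
  · rw [← hit, hw, hk]
    congr 1
    omega
  · rw [← hit, ← hk] at e
    exact g.injective e

end ParentMap

/-- A sequence with `t i ≤ t (i + k)` is eventually rigid: beyond some index, two of its tails that
agree far out agree throughout. Either the sequence is eventually periodic with period `k`, or no
two distinct tails of it agree far out. -/
theorem exists_tail_rigid {α : Type*} [PartialOrder α] (t : ℕ → α) {k : ℕ} (hk : 0 < k)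
    (hmono : ∀ i, t i ≤ t (i + k)) :
    ∃ i₁, ∀ a b, i₁ ≤ a → i₁ ≤ b → ∀ J, (∀ j, J ≤ j → t (a + j) = t (b + j)) → t a = t b := by
  by_cases hper : ∃ i₁, ∀ i, i₁ ≤ i → t (i + k) = t i
  · obtain ⟨i₁, hi₁⟩ := hper
    have hmul : ∀ n i, i₁ ≤ i → t (i + n * k) = t i := by
      intro n
      induction n with
      | zero => simp
      | succ n ih =>
        intro i hi
        rw [add_mul, one_mul, ← add_assoc, hi₁ _ (by omega), ih i hi]
    refine ⟨i₁, fun a b ha hb J hJ => ?_⟩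
    rw [← hmul J a ha, ← hmul J b hb, hJ _ (Nat.le_mul_of_pos_right J hk)]
  · have key : ∀ a c J, (∀ j, J ≤ j → t (a + j) = t (a + (c + 1) + j)) → False := by
      intro a c J hJ
      refine hper ⟨a + J, fun i hi => ?_⟩
      have hc : ∀ n, t (i + n * (c + 1)) = t i := by
        intro n
        induction n with
        | zero => simp
        | succ n ih =>
          rw [← ih]
          have := hJ (i - a + n * (c + 1)) (by omega)
          rw [show a + (i - a + n * (c + 1)) = i + n * (c + 1) by omega] at this
          rw [this]
          congr 1
          rw [add_mul, one_mul]
          omega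
      have hle : ∀ n, t (i + k) ≤ t (i + k + n * k) := by
        intro n
        induction n with
        | zero => simp
        | succ n ih =>
          refine ih.trans ((hmono _).trans_eq ?_)
          rw [add_mul, one_mul, ← add_assoc]
      refine le_antisymm ((hle c).trans_eq ?_) (hmono i)
      rw [← hc k]
      congr 1
      ring
    refine ⟨0, fun a b _ _ J hJ => ?_⟩
    rcases lt_trichotomy a b with hab | rfl | hab
    · obtain ⟨c, rfl⟩ := Nat.exists_eq_add_of_lt hab
      exact (key a c J hJ).elim
    · rfl
    · obtain ⟨c, rfl⟩ := Nat.exists_eq_add_of_lt hab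
      exact (key b c J fun j hj => (hJ j hj).symm).elim

namespace ParentMap

variable {T : SimpleGraph V} {π : V → V} {x : ℕ → V}

/-- Two trimmed trees whose generation counts agree after a shift along the ray are trimmed at
the same place, if this happens in the range where the branch counts are rigid. -/
theorem eq_of_generationCount_eq (h : ParentMap T π x) (hfin : ∀ v, {w | π w = v}.Finite) {i₁ : ℕ}
    (hrigid : ∀ a b, i₁ ≤ a → i₁ ≤ b → ∀ J,
      (∀ j, J ≤ j → branchCount π x (a + j) = branchCount π x (b + j)) →
        branchCount π x a = branchCount π x b)
    {m m' a b : ℕ} (him : i₁ ≤ m) (him' : i₁ ≤ m') (hm : ∃ c, π c = x (m + 1) ∧ c ≠ x m)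
    (hm' : ∃ c, π c = x (m' + 1) ∧ c ≠ x m')
    (hab : ∀ j r, generationCount π x (trimmed π x m) (a + j) r =
      generationCount π x (trimmed π x m') (b + j) r) : m = m' := by
  wlog hle : b + m ≤ a + m' generalizing m m' a b
  · exact (this him' him hm' hm (fun j r => (hab j r).symm) (by omega)).symm
  by_contra hne
  obtain ⟨c, hc, hcx⟩ := hm
  -- In the first tree, `x i` corresponds to `x m'` in the second one.
  obtain ⟨i, hi⟩ : ∃ i, a + m' = b + i := ⟨a + m' - b, by omega⟩
  have hgen : ∀ j, b ≤ j → ∀ r, generationCount π x (trimmed π x m) (i + j) r =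
      generationCount π x (trimmed π x m') (m' + j) r := by
    intro j hj r
    have := hab (m' + j - b) r
    rwa [show a + (m' + j - b) = i + j by omega, show b + (m' + j - b) = m' + j by omega] at this
  have hbranch : ∀ j, b ≤ j → branchCount π x (i + j) = branchCount π x (m' + j) := by
    intro j hj
    funext r
    have h₁ := hgen (j + 1) (by omega) (r + 1)
    rw [← add_assoc, ← add_assoc, h.generationCount_trimmed_succ hfin (by omega),
      h.generationCount_trimmed_succ hfin (by omega), hgen j hj] at h₁
    omega
  refine h.generationCount_ne hfin hne (i := i) (by omega) hc hcx (fun j r => ?_) b (hgen b le_rfl)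
  refine congrFun (hrigid (i + j) (m' + j) (by omega) (by omega) b fun l hl => ?_) r
  rw [add_assoc, add_assoc]
  exact hbranch _ (by omega)

/-- If all self-embeddings of the tree respect the parent map, then isomorphisms between trimmed
trees do so, too, and preserve the generation counts up to a shift along the ray. -/
theorem exists_generationCount_eq (h : ParentMap T π x)
    (hcomm : ∀ (e : TreeEmb T T) v, e (π v) = π (e v)) {m m' : ℕ} (g : TreeEmb T T) {k : ℕ}
    (hk : ∀ i, g (x i) = x (i + k)) (hg : ∀ v, g v ∈ trimmed π x m)
    (f : T.induce (trimmed π x m) ≃g T.induce (trimmed π x m')) :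
    ∃ a b, ∀ j r, generationCount π x (trimmed π x m) (a + j) r =
      generationCount π x (trimmed π x m') (b + j) r := by
  have hU := h.restrict (h.mapsTo_trimmed m) (ray_mem_trimmed m)
  have hU' := h.restrict (h.mapsTo_trimmed m') (ray_mem_trimmed m')
  let e : TreeEmb T T := ⟨⟨fun v => f ⟨g v, hg v⟩, fun hvw =>
    (f.map_rel_iff'.2 (show (T.induce (trimmed π x m)).Adj ⟨g _, hg _⟩ ⟨g _, hg _⟩ from
      g.toHom.map_adj hvw) :)⟩, fun v w hvw =>
    g.injective (congrArg Subtype.val (f.injective (Subtype.ext hvw)))⟩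
  have hev : ∀ v, e v = f ⟨g v, hg v⟩ := fun _ => rfl
  have hf := hU.commute_of_eventually hU' f.toCopy (N := k) (by
    intro i hi
    obtain ⟨i, rfl⟩ := Nat.exists_eq_add_of_le' hi
    have h₁ := hcomm e (x i)
    rw [hev, hev, h.map_ray] at h₁
    simp only [hk] at h₁
    apply Subtype.ext
    rw [hU.map_ray]
    refine Eq.trans ?_ h₁
    exact congrArg (fun z => (f z : V)) (Subtype.ext (congrArg x (by omega))))
  have hf' : ∀ (n : ℕ) v (hv : v ∈ trimmed π x m), ∃ hn : π^[n] v ∈ trimmed π x m,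
      (f ⟨π^[n] v, hn⟩ : V) = π^[n] (f ⟨v, hv⟩) := by
    intro n
    induction n with
    | zero => exact fun v hv => ⟨hv, rfl⟩
    | succ n ih =>
      intro v hv
      obtain ⟨hn, e⟩ := ih _ (h.mapsTo_trimmed m hv)
      exact ⟨hn, e.trans (congrArg π^[n] (congrArg Subtype.val (hf ⟨v, hv⟩)))⟩
  obtain ⟨a, b, hb⟩ := h.merge (f ⟨x 0, ray_mem_trimmed m 0⟩)
  have hray : ∀ j, (f ⟨x (a + j), ray_mem_trimmed m _⟩ : V) = x (b + j) := by
    intro j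
    obtain ⟨hn, e⟩ := hf' (j + a) (x 0) (ray_mem_trimmed m 0)
    replace e := e.trans ((iterate_add_apply _ _ _ _).trans (by rw [hb, h.iterate_ray]))
    refine Eq.trans (congrArg (fun z => (f z : V)) (Subtype.ext ?_)) e
    change x (a + j) = π^[j + a] (x 0)
    rw [h.iterate_ray]
    exact congrArg x (by omega)
  refine ⟨a, b, fun j r => Set.ncard_congr (fun w hw => (f ⟨w, hw.1⟩ : V)) ?_ ?_ ?_⟩
  · rintro w ⟨hw, e⟩
    obtain ⟨hn, e'⟩ := hf' r w hw
    refine ⟨(f ⟨w, hw⟩).2, ?_⟩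
    rw [← e', ← hray]
    congr 3
  · intro v w hv hw hvw
    exact congrArg Subtype.val (f.injective (Subtype.ext hvw))
  · rintro w ⟨hw, e⟩
    obtain ⟨⟨v, hv⟩, hvw⟩ := f.surjective ⟨w, hw⟩
    obtain ⟨hn, e'⟩ := hf' r v hv
    refine ⟨v, ⟨hv, ?_⟩, congrArg Subtype.val hvw⟩
    rw [hvw, e, ← hray] at e'
    exact congrArg Subtype.val (f.injective (Subtype.ext e'))

/-- If all self-embeddings respect the parent map, then the trimmed trees provide infinitely many
siblings. -/
theorem infinite_siblings_of_commute (h : ParentMap T π x) (hT : T.IsTree)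
    (hfin : ∀ v, {w | π w = v}.Finite) (hcomm : ∀ (e : TreeEmb T T) v, e (π v) = π (e v))
    (g : TreeEmb T T) {k : ℕ} (hkpos : 0 < k) (hk : ∀ i, g (x i) = x (i + k))
    (hbranch : ∀ N, ∃ m, N ≤ m ∧ ∃ c, π c = x (m + 1) ∧ c ≠ x m)
    (htrim : ∀ m, ∃ (e : TreeEmb T T) (l : ℕ), (∀ i, e (x i) = x (i + l)) ∧
      ∀ v, e v ∉ descendants π (x m)) :
    Infinite (Quotient (siblingSetoid T)) := by
  obtain ⟨i₁, hi₁⟩ := exists_tail_rigid (branchCount π x) hkpos fun i r =>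
    branchCount_le hfin (hcomm g) hk i r
  let M : Set ℕ := {m | i₁ ≤ m ∧ ∃ c, π c = x (m + 1) ∧ c ≠ x m}
  have hM : M.Infinite := by
    refine Set.infinite_of_not_bddAbove ?_
    rintro ⟨B, hB⟩
    obtain ⟨m, hm, hc⟩ := hbranch (i₁ + B + 1)
    have := hB (show m ∈ M from ⟨by omega, hc⟩)
    omega
  have := hM.to_subtype
  choose e l hl he using htrim
  let S : ℕ → Sibling T := fun m => siblingOfInduce hT (trimmed π x m)
    (h.restrict (h.mapsTo_trimmed m) (ray_mem_trimmed m)).connected (e m)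
    fun v => .inr (he m v)
  refine Infinite.of_injective (fun m : M => Quotient.mk (siblingSetoid T) (S m)) ?_
  rintro ⟨m, him, hm⟩ ⟨m', him', hm'⟩ hmm
  obtain ⟨f⟩ := Quotient.exact hmm
  obtain ⟨a, b, hab⟩ := h.exists_generationCount_eq hcomm (e m) (hl m)
    (fun v => .inr (he m v)) f
  exact Subtype.ext (h.eq_of_generationCount_eq hfin hi₁ him him' hm hm' hab)

end ParentMap

namespace ParentMap

variable {T : SimpleGraph V} {π : V → V} {x : ℕ → V}

/-! ### Self-embeddings that move the end of the ray -/

/-- A self-embedding that does not respect the parent map moves the end of the ray: it turns a tail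
of the ray upside down, and therefore maps everything that does not lie below some `x N` into the
descendants of a single vertex of the ray. -/
theorem exists_image_subset_descendants (h : ParentMap T π x) (e : TreeEmb T T) {v : V}
    (hv : e (π v) ≠ π (e v)) :
    ∃ N i, ∀ w, w ∉ descendants π (x N) → e w ∈ descendants π (x i) := by
  have hrev : ∀ a, π (e (π (π^[a] v))) = e (π^[a] v) := fun a =>
    h.reverse_of_not_commute h e fun ha => hv (h.commute_of_commute_iterate h e a v ha)
  obtain ⟨b, N, hb⟩ := h.merge v
  have hray : ∀ j, π^[j] (e (x (N + j))) = e (x N) := by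
    intro j
    induction j with
    | zero => rfl
    | succ j ih =>
      have := hrev (j + b)
      rw [iterate_add_apply, hb, h.iterate_ray, h.map_ray] at this
      rw [iterate_succ_apply, ← add_assoc, this, ih]
  have key : ∀ a w, (∃ i, π^[a] w = x i) → w ∉ descendants π (x N) →
      e w ∈ descendants π (e (x N)) := by
    intro a
    induction a with
    | zero =>
      rintro w ⟨i, rfl⟩ hw
      have hNi : N ≤ i := by
        by_contra hlt
        refine hw ⟨N - i, ?_⟩
        rw [h.iterate_ray]
        congr 1
        omega
      refine ⟨i - N, ?_⟩
      rw [← hray (i - N), Nat.add_sub_cancel' hNi]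
    | succ a ih =>
      rintro w ⟨i, hi⟩ hw
      obtain ⟨n, hn⟩ := ih (π w) ⟨i, hi⟩ (not_mem_descendants_parent hw)
      rcases (h.adj_iff _ _).1 (e.toHom.map_adj (h.adj_parent w)) with hup | hdown
      · change π (e w) = e (π w) at hup
        exact ⟨n + 1, by rw [iterate_succ_apply, hup, hn]⟩
      · change π (e (π w)) = e w at hdown
        cases n with
        | zero => exact absurd ⟨1, e.injective hn⟩ hw
        | succ n => exact ⟨n, by rw [← hdown]; exact hn⟩
  obtain ⟨c, i, hc⟩ := h.merge (e (x N))
  refine ⟨N, i, fun w hw => ?_⟩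
  obtain ⟨a, l, hl⟩ := h.merge w
  obtain ⟨n, hn⟩ := key a w ⟨l, hl⟩ hw
  exact ⟨c + n, by rw [iterate_add_apply, hn, hc]⟩

theorem child_ne_ray (h : ParentMap T π x) {m : ℕ} {c : V} (hc : π c = x (m + 1)) (hne : c ≠ x m)
    (i : ℕ) : x i ≠ c := by
  rintro rfl
  rw [h.map_ray] at hc
  have := h.ray_injective hc
  exact hne (congrArg x (by omega))

/-- If `T` embeds below a vertex of the ray, then the branches further out can be removed at will.
The sets of branches contain a chain of the order type of `ℝ`, and the members of the resulting
chain of siblings, rooted at `x 0`, are pairwise non-isomorphic because locally finite rooted trees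
are rigid. Since a sibling has only countably many vertices that may serve as the root, there are
infinitely (in fact uncountably) many siblings. -/
theorem infinite_siblings_of_subset_descendants [T.LocallyFinite] (h : ParentMap T π x)
    (hT : T.IsTree) (hbranch : ∀ N, ∃ m, N ≤ m ∧ ∃ c, π c = x (m + 1) ∧ c ≠ x m)
    (e : TreeEmb T T) {i₀ : ℕ} (he : ∀ v, e v ∈ descendants π (x i₀)) :
    Infinite (Quotient (siblingSetoid T)) := by
  have := h.countable h.finite_children
  let M : Set ℕ := {m | i₀ ≤ m ∧ ∃ c, π c = x (m + 1) ∧ c ≠ x m}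
  have hM : M.Infinite := by
    refine Set.infinite_of_not_bddAbove ?_
    rintro ⟨B, hB⟩
    obtain ⟨m, hm, hc⟩ := hbranch (i₀ + B + 1)
    have := hB (show m ∈ M from ⟨by omega, hc⟩)
    omega
  have := hM.to_subtype
  obtain ⟨q⟩ := nonempty_equiv_of_countable (α := M) (β := ℚ)
  choose c hc hcx using fun m : M => m.2.2
  let U : ℝ → Set V := fun r => {w | ∀ m, r ≤ q m → w ∉ descendants π (c m)}
  have hU : ∀ r, Set.MapsTo π (U r) (U r) := fun r w hw m hm =>
    not_mem_descendants_parent (hw m hm)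
  have hxU : ∀ r i, x i ∈ U r := by
    rintro r i m - ⟨a, ha⟩
    rw [h.iterate_ray] at ha
    exact h.child_ne_ray (hc m) (hcx m) _ ha
  have heU : ∀ r v, e v ∈ U r := by
    rintro r v m - ⟨b, hb⟩
    obtain ⟨a, ha⟩ := he v
    rcases Nat.lt_or_ge b a with hab | hab
    · obtain ⟨d, rfl⟩ := Nat.exists_eq_add_of_lt hab
      rw [show b + d + 1 = d + 1 + b by omega, iterate_add_apply, hb, iterate_succ_apply, hc,
        h.iterate_ray] at ha
      have := h.ray_injective ha
      have := m.2.1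
      omega
    · obtain ⟨d, rfl⟩ := Nat.exists_eq_add_of_le' hab
      rw [iterate_add_apply, ha, h.iterate_ray] at hb
      exact h.child_ne_ray (hc m) (hcx m) _ hb
  have hmono : ∀ {r r' : ℝ}, r < r' → U r ⊆ U r' := fun hr w hw m hm => hw m (hr.le.trans hm)
  have hstrict : ∀ {r r' : ℝ}, r < r' → ¬ U r' ⊆ U r := by
    intro r r' hr hsub
    obtain ⟨s, hs, hs'⟩ := exists_rat_btwn hr
    have hmem : c (q.symm s) ∈ U r' := by
      rintro m hm ⟨_ | a, ha⟩
      · have h₁ := congrArg π ha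
        rw [iterate_zero_apply, hc, hc] at h₁
        have h₂ : q.symm s = m := Subtype.ext (by have := h.ray_injective h₁; omega)
        rw [← h₂, Equiv.apply_symm_apply] at hm
        exact absurd hs' (not_lt.2 hm)
      · rw [iterate_succ_apply, hc, h.iterate_ray] at ha
        exact h.child_ne_ray (hc m) (hcx m) _ ha
    exact hsub hmem (q.symm s) (by rw [Equiv.apply_symm_apply]; exact hs.le) ⟨0, rfl⟩
  let S : ℝ → Sibling T := fun r => siblingOfInduce hT (U r)
    (h.restrict (hU r) (hxU r)).connected e (heU r)
  by_contra hfin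
  rw [not_infinite_iff_finite] at hfin
  have hcount : ∀ Q : Quotient (siblingSetoid T), Countable Q.out.Vert := fun Q => by
    obtain ⟨f⟩ := Q.out.areSiblings.2
    exact f.injective.countable
  have hroot : ∀ r, ∃ p : Σ Q : Quotient (siblingSetoid T), Q.out.Vert,
      ∃ f : T.induce (U r) ≃g p.1.out.graph, f ⟨x 0, hxU r 0⟩ = p.2 := by
    intro r
    obtain ⟨f⟩ := Quotient.mk_out (s := siblingSetoid T) (S r)
    exact ⟨⟨Quotient.mk (siblingSetoid T) (S r), f.symm ⟨x 0, hxU r 0⟩⟩, f.symm, rfl⟩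
  choose F hF using hroot
  obtain ⟨r, r', hrr, hne⟩ : ∃ r r', F r = F r' ∧ r ≠ r' := by
    have := not_injective_uncountable_countable F
    simpa [Injective] using this
  wlog hlt : r < r' generalizing r r'
  · exact this r' r hrr.symm hne.symm (lt_of_le_of_ne (not_lt.1 hlt) hne.symm)
  have hFr := hF r
  rw [hrr] at hFr
  obtain ⟨f, hf⟩ := hFr
  obtain ⟨f', hf'⟩ := hF r'
  let ψ : TreeEmb (T.induce (U r')) (T.induce (U r')) :=
    ⟨⟨fun v => ⟨f.symm (f' v), hmono hlt (f.symm (f' v)).2⟩, fun hvw =>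
      f.symm.map_rel_iff'.2 (f'.map_rel_iff'.2 hvw)⟩, fun v w hvw =>
      f'.injective (f.symm.injective (Subtype.ext (congrArg Subtype.val hvw :)))⟩
  have hψ : ψ ⟨x 0, hxU r' 0⟩ = ⟨x 0, hxU r' 0⟩ := by
    refine Subtype.ext ?_
    change (f.symm (f' ⟨x 0, hxU r' 0⟩) : V) = x 0
    rw [hf', ← hf, RelIso.symm_apply_apply]
  have hsurj := surjective_of_fixed (h.restrict (hU r') (hxU r')).connected.preconnected
    (fun v => ((Set.toFinite (T.neighborSet v)).preimage Subtype.val_injective.injOn).subset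
      fun _ hw => hw) ψ hψ
  refine hstrict hlt fun w hw => ?_
  obtain ⟨v, hv⟩ := hsurj ⟨w, hw⟩
  rw [← show (ψ v : V) = w from congrArg Subtype.val hv]
  exact (f.symm (f' v)).2

/-- A tree with a self-embedding that moves the ray into itself and whose iterates leave the
descendants of every vertex of the ray has infinitely many siblings, provided that the ray has
branches arbitrarily far out. -/
theorem infinite_siblings [T.LocallyFinite] (h : ParentMap T π x) (hT : T.IsTree)
    (g : TreeEmb T T) {k : ℕ} (hkpos : 0 < k) (hk : ∀ i, g (x i) = x (i + k))
    (hbranch : ∀ N, ∃ m, N ≤ m ∧ ∃ c, π c = x (m + 1) ∧ c ≠ x m)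
    (htrim : ∀ m, ∃ (e : TreeEmb T T) (l : ℕ), (∀ i, e (x i) = x (i + l)) ∧
      ∀ v, e v ∉ descendants π (x m)) :
    Infinite (Quotient (siblingSetoid T)) := by
  by_cases hcomm : ∀ (e : TreeEmb T T) v, e (π v) = π (e v)
  · exact h.infinite_siblings_of_commute hT h.finite_children hcomm g hkpos hk hbranch htrim
  · push Not at hcomm
    obtain ⟨e, v, hv⟩ := hcomm
    obtain ⟨N, i, hNi⟩ := h.exists_image_subset_descendants e hv
    obtain ⟨e', -, -, he'⟩ := htrim N
    exact h.infinite_siblings_of_subset_descendants hT hbranch (e.comp e')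
      fun w => hNi _ (he' w)

end ParentMap

/-! ### The parent map towards an end -/

/-- The ray in `T` given by an injective sequence of successively adjacent vertices. -/
def Ray.ofSeq {T : SimpleGraph V} (f : ℕ → V) (hadj : ∀ i, T.Adj (f i) (f (i + 1)))
    (hf : Injective f) : Ray T :=
  ⟨⟨f, fun {i j} hij => by
    simp only [SimpleGraph.hasse_adj, Order.covBy_iff_add_one_eq] at hij
    rcases hij with rfl | rfl
    · exact hadj i
    · exact (hadj j).symm⟩, hf⟩

/-- The ray `R` without its first `n` vertices. -/
def Ray.drop {T : SimpleGraph V} (R : Ray T) (n : ℕ) : Ray T :=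
  Ray.ofSeq (fun i => R (n + i)) (fun i => ray_adj R _)
    fun i j e => by have := R.injective e; omega

/-- In a forest, a ray can be prolonged by any neighbour of its first vertex other than the second
vertex of the ray. -/
theorem exists_cons_ray {T : SimpleGraph V} (hT : T.IsAcyclic) (Q : Ray T) {w : V}
    (hadj : T.Adj (Q 0) w) (hw : Q 1 ≠ w) : ∃ P : Ray T, P 0 = w ∧ ∀ k, P (k + 1) = Q k := by
  have hnot : ∀ j, Q j ≠ w := by
    rintro j rfl
    obtain ⟨p, hp, -⟩ := ray_segment Q 0 j
    have hpq := (hT.subsingleton_path _ _).elim (⟨p.1.copy rfl (by rw [zero_add]),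
      by simp⟩ : T.Path (Q 0) (Q j)) (SimpleGraph.Path.singleton hadj)
    have hlen := congrArg (fun q : T.Path (Q 0) (Q j) => q.1.length) hpq
    simp only [SimpleGraph.Path.singleton, SimpleGraph.Walk.length_copy, hp,
      SimpleGraph.Walk.length_cons, SimpleGraph.Walk.length_nil, zero_add] at hlen
    exact hw (congrArg Q hlen.symm)
  refine ⟨Ray.ofSeq (fun i => i.casesOn w Q) ?_ ?_, rfl, fun k => rfl⟩
  · rintro (_ | i)
    · exact hadj.symm
    · exact ray_adj Q i
  · rintro (_ | i) (_ | j) e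
    · rfl
    · exact absurd e.symm (hnot j)
    · exact absurd e (hnot i)
    · exact congrArg Nat.succ (Q.injective e)

/-- From each vertex of a tree starts a ray that eventually runs along a given ray: such a ray is
passed on from a vertex to its neighbours, by removing or adding a vertex. -/
theorem exists_ray_from {T : SimpleGraph V} (hT : T.IsTree) (R : Ray T) (v : V) :
    ∃ Q : Ray T, Q 0 = v ∧ ∃ m n, ∀ k, Q (m + k) = R (n + k) := by
  have step : ∀ v w, T.Adj v w → (∃ Q : Ray T, Q 0 = v ∧ ∃ m n, ∀ k, Q (m + k) = R (n + k)) →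
      ∃ Q : Ray T, Q 0 = w ∧ ∃ m n, ∀ k, Q (m + k) = R (n + k) := by
    rintro v w hvw ⟨Q, rfl, m, n, hQ⟩
    by_cases hw : Q 1 = w
    · refine ⟨Q.drop 1, hw, m, n + 1, fun k => ?_⟩
      change Q (1 + (m + k)) = _
      rw [add_left_comm, hQ, add_assoc]
    · obtain ⟨P, hP₀, hP⟩ := exists_cons_ray hT.isAcyclic Q hvw hw
      exact ⟨P, hP₀, m + 1, n, fun k => by rw [add_right_comm, hP, hQ]⟩
  obtain ⟨p⟩ := hT.connected.preconnected (R 0) v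
  have walk : ∀ {u v} (_ : T.Walk u v),
      (∃ Q : Ray T, Q 0 = u ∧ ∃ m n, ∀ k, Q (m + k) = R (n + k)) →
        ∃ Q : Ray T, Q 0 = v ∧ ∃ m n, ∀ k, Q (m + k) = R (n + k) := by
    intro u v p
    induction p with
    | nil => exact id
    | cons hadj _ ih => exact fun hu => ih (step _ _ hadj hu)
  exact walk p ⟨R, rfl, 0, 0, fun _ => rfl⟩

theorem ray_from_unique {T : SimpleGraph V} (hT : T.IsTree) {R Q Q' : Ray T} (h₀ : Q 0 = Q' 0)
    (hQ : ∃ m n, ∀ k, Q (m + k) = R (n + k)) (hQ' : ∃ m n, ∀ k, Q' (m + k) = R (n + k)) (j : ℕ) :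
    Q j = Q' j := by
  obtain ⟨m, n, hQ⟩ := hQ
  obtain ⟨m', n', hQ'⟩ := hQ'
  have h₁ : Q (0 + (m + (n' + j))) = Q' (0 + (m' + (n + j))) := by
    rw [zero_add, zero_add, hQ, hQ']
    congr 1
    omega
  simpa using ray_agree hT.isAcyclic Q Q' h₀ h₁ j (by omega)

/-- In a tree, every ray determines a parent map: the parent of `v` is the second vertex of the ray
from `v` that eventually runs along the given ray. -/
theorem exists_parentMap {T : SimpleGraph V} (hT : T.IsTree) (R : Ray T) :
    ∃ π, ParentMap T π R := by
  choose Q hQ₀ hQ using exists_ray_from hT R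
  have huniq : ∀ (P : Ray T), (∃ m n, ∀ k, P (m + k) = R (n + k)) → ∀ j, Q (P 0) j = P j :=
    fun P hP => ray_from_unique hT (hQ₀ _) (hQ _) hP
  have htail : ∀ v j, Q (Q v 1) j = Q v (j + 1) := by
    intro v j
    obtain ⟨m, n, h⟩ := hQ v
    rw [add_comm]
    refine huniq ((Q v).drop 1) ⟨m, n + 1, fun k => ?_⟩ j
    change Q v (1 + (m + k)) = _
    rw [add_left_comm, h, add_assoc]
  have hiter : ∀ a v, (fun v => Q v 1)^[a] v = Q v a := by
    intro a
    induction a with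
    | zero => exact fun v => (hQ₀ v).symm
    | succ a ih => exact fun v => by rw [iterate_succ_apply, ih, htail]
  refine ⟨fun v => Q v 1, ?_, ?_, R.injective, ?_⟩
  · intro v w
    have hadj : ∀ v, T.Adj v (Q v 1) := fun v => by
      have := ray_adj (Q v) 0
      rwa [hQ₀] at this
    constructor
    · intro hvw
      -- Prolonging the ray from `v` by `w` yields the ray from `w`.
      refine or_iff_not_imp_left.2 fun hne => ?_
      obtain ⟨P, rfl, hP⟩ := exists_cons_ray hT.isAcyclic (Q v) ((hQ₀ v).symm ▸ hvw) hne
      obtain ⟨m, n, h⟩ := hQ v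
      exact (huniq P ⟨m + 1, n, fun k => by rw [add_right_comm, hP, h]⟩ 1).trans
        ((hP 0).trans (hQ₀ v))
    · rintro (rfl | rfl)
      · exact hadj v
      · exact (hadj w).symm
  · intro i
    exact huniq (R.drop i) ⟨0, i, fun k => by rw [zero_add]; rfl⟩ 1
  · intro v
    obtain ⟨m, n, h⟩ := hQ v
    exact ⟨m, n, by rw [hiter]; exact h 0⟩

theorem rayEquiv_of_mk_eq {T : SimpleGraph V} (hT : T.IsAcyclic) {R S : Ray T}
    (h : (Quot.mk RayEquiv R : TreeEnd T) = Quot.mk RayEquiv S) : RayEquiv R S :=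
  (rayEquiv_equivalence hT).eqvGen_iff.1 (Quot.eqvGen_exact h)

/-! ### Parabolic embeddings -/

namespace ParentMap

variable {T : SimpleGraph V} {π : V → V} {x : ℕ → V}

/-- If an embedding translates an infinite sequence of descendants, in either direction, then it
fixes the end towards which this sequence descends, which differs from the end of the ancestors. -/
theorem false_of_descending (hT : T.IsTree) {R : Ray T} (h : ParentMap T π R) {g : TreeEmb T T}
    (hg : ∀ v, g (π v) = π (g v))
    (huniq : ∀ η : TreeEnd T, TreeEnd.map g η = η → η = Quot.mk RayEquiv R)
    {y : ℕ → V} {k : ℕ} (hy : ∀ n, π^[k + 1] (y (n + 1)) = y n)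
    (hgy : (∀ n, g (y n) = y (n + 1)) ∨ ∀ n, g (y (n + 1)) = y n) : False := by
  have hit : ∀ n v, g (π^[n] v) = π^[n] (g v) := fun n v =>
    (Function.Semiconj.iterate_right (f := g) (ga := π) (gb := π) hg n) v
  have hy' : ∀ a n, π^[(k + 1) * a] (y (n + a)) = y n := by
    intro a
    induction a with
    | zero => exact fun n => rfl
    | succ a ih =>
      intro n
      rw [mul_add, mul_one, iterate_add_apply, ← add_assoc, hy, ih]
  -- `y j` lies `(k + 1) * j` generations below `y 0`, and its ancestor `z j` only `j` of them.
  let z : ℕ → V := fun j => π^[k * j] (y j)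
  have hz : ∀ j, π (z (j + 1)) = z j := by
    intro j
    change π (π^[k * (j + 1)] (y (j + 1))) = π^[k * j] (y j)
    rw [← hy j, ← iterate_succ_apply' π, ← iterate_add_apply]
    rfl
  have hzit : ∀ a j, π^[a] (z (j + a)) = z j := by
    intro a
    induction a with
    | zero => exact fun j => rfl
    | succ a ih => exact fun j => by rw [iterate_succ_apply, ← add_assoc, hz, ih]
  have hinj : Injective z := by
    have hlt : ∀ i d, z i ≠ z (i + d + 1) := fun i d e =>
      h.iterate_succ_ne d (z (i + d + 1)) ((hzit (d + 1) i).trans e)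
    intro i j e
    rcases lt_trichotomy i j with hij | hij | hij
    · obtain ⟨d, rfl⟩ := Nat.exists_eq_add_of_lt hij
      exact absurd e (hlt i d)
    · exact hij
    · obtain ⟨d, rfl⟩ := Nat.exists_eq_add_of_lt hij
      exact absurd e.symm (hlt j d)
  let Z : Ray T := Ray.ofSeq z (fun i => (h.adj_iff _ _).2 (.inr (hz i))) hinj
  have hZ : ∀ i, Z i = z i := fun _ => rfl
  have hfix : RayEquiv (g.comp Z) Z := by
    rw [rayEquiv_iff hT.isAcyclic]
    rcases hgy with hgy | hgy
    · refine ⟨0, k + 1, fun j => ?_⟩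
      rw [SimpleGraph.Copy.comp_apply, hZ, hZ, zero_add]
      change g (π^[k * j] (y j)) = π^[k * (k + 1 + j)] (y (k + 1 + j))
      rw [hit, hgy, ← hy' k (j + 1), ← iterate_add_apply]
      congr 2 <;> ring
    · refine ⟨k + 1, 0, fun j => ?_⟩
      rw [SimpleGraph.Copy.comp_apply, hZ, hZ, zero_add]
      change g (π^[k * (k + 1 + j)] (y (k + 1 + j))) = π^[k * j] (y j)
      rw [hit, show k + 1 + j = j + k + 1 by ring, hgy, ← hy' k j, ← iterate_add_apply]
      congr 2
      ring
  obtain ⟨m, n, hmn⟩ := (rayEquiv_iff hT.isAcyclic _ _).1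
    (rayEquiv_of_mk_eq hT.isAcyclic (huniq (Quot.mk _ Z) (Quot.sound hfix)))
  -- Two consecutive vertices common to both rays are passed in opposite directions.
  have h₁ : R (n + 1 + 1) = R (n + 0) := by
    rw [← h.map_ray, ← hmn 1, ← hmn 0]
    exact hz m
  have := R.injective h₁
  omega

/-- If `π` is injective but not surjective, then the tree is a ray: it consists of the ancestors of
its only leaf. -/
theorem isRay_of_injective (h : ParentMap T π x) (hinj : Injective π) {w : V}
    (hw : ∀ v, π v ≠ w) : IsRay T := by
  have hsucc : ∀ i, π (π^[i] w) = π^[i + 1] w := fun i => (iterate_succ_apply' π i w).symm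
  have hinj' : Injective fun i => π^[i] w := by
    have hlt : ∀ i d, π^[i] w ≠ π^[i + d + 1] w := fun i d e =>
      h.iterate_succ_ne d w (hinj.iterate i (by rw [← iterate_add_apply, e]; congr 1)).symm
    intro i j e
    rcases lt_trichotomy i j with hij | hij | hij
    · obtain ⟨d, rfl⟩ := Nat.exists_eq_add_of_lt hij
      exact absurd e (hlt i d)
    · exact hij
    · obtain ⟨d, rfl⟩ := Nat.exists_eq_add_of_lt hij
      exact absurd e.symm (hlt j d)
  have hsurj : Surjective fun i => π^[i] w := by
    intro v
    obtain ⟨a, i, ha⟩ := h.merge v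
    obtain ⟨b, j, hb⟩ := h.merge w
    have hab : π^[j + a] v = π^[i + b] w := by
      rw [iterate_add_apply, ha, iterate_add_apply, hb, h.iterate_ray, h.iterate_ray, add_comm]
    rcases Nat.lt_or_ge (i + b) (j + a) with hlt | hge
    · obtain ⟨d, hd⟩ := Nat.exists_eq_add_of_lt hlt
      rw [hd, add_assoc, iterate_add_apply] at hab
      have := hinj.iterate _ hab
      rw [iterate_succ_apply'] at this
      exact absurd this (hw _)
    · obtain ⟨d, hd⟩ := Nat.exists_eq_add_of_le hge
      rw [hd, iterate_add_apply _ (j + a) d] at hab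
      exact ⟨d, (hinj.iterate _ hab).symm⟩
  refine ⟨RelIso.symm ⟨Equiv.ofBijective _ ⟨hinj', hsurj⟩, fun {i j} => ?_⟩⟩
  change T.Adj (π^[i] w) (π^[j] w) ↔ _
  rw [h.adj_iff, hsucc, hsucc, SimpleGraph.hasse_adj, Order.covBy_iff_add_one_eq,
    Order.covBy_iff_add_one_eq]
  exact or_congr hinj'.eq_iff hinj'.eq_iff

/-- If two distinct vertices outside the descendants of `x N` have the same parent, then the ray has
a branch beyond `x N`. -/
theorem exists_branch (h : ParentMap T π x) {N : ℕ} {u w : V} (hu : u ∉ descendants π (x N))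
    (hw : w ∉ descendants π (x N)) (hne : u ≠ w) (huw : π u = π w) :
    ∃ m, N ≤ m ∧ ∃ c, π c = x (m + 1) ∧ c ≠ x m := by
  -- A vertex off the ray has a first ancestor on the ray, where the ray branches.
  have key : ∀ a v, v ∉ descendants π (x N) → v ∉ Set.range x → (∃ i, π^[a] v = x i) →
      ∃ m, N ≤ m ∧ ∃ c, π c = x (m + 1) ∧ c ≠ x m := by
    intro a
    induction a with
    | zero => exact fun v _ hv ⟨i, hi⟩ => absurd ⟨i, hi.symm⟩ hv
    | succ a ih =>
      rintro v hvN hv ⟨i, hi⟩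
      by_cases hπv : π v ∈ Set.range x
      · obtain ⟨j, hj⟩ := hπv
        have hNj : N < j := by
          by_contra hle
          refine hvN ⟨N - j + 1, ?_⟩
          rw [iterate_succ_apply, ← hj, h.iterate_ray]
          congr 1
          omega
        obtain ⟨m, rfl⟩ := Nat.exists_eq_add_of_le' (Nat.one_le_of_lt hNj)
        exact ⟨m, by omega, v, hj.symm, fun e => hv ⟨m, e.symm⟩⟩
      · exact ih (π v) (not_mem_descendants_parent hvN) hπv ⟨i, hi⟩
  by_cases hxu : u ∈ Set.range x
  · by_cases hxw : w ∈ Set.range x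
    · obtain ⟨i, rfl⟩ := hxu
      obtain ⟨j, rfl⟩ := hxw
      rw [h.map_ray, h.map_ray] at huw
      have := h.ray_injective huw
      exact absurd (congrArg x (by omega)) hne
    · obtain ⟨a, ha⟩ := h.merge w
      exact key a w hw hxw ha
  · obtain ⟨a, ha⟩ := h.merge u
    exact key a u hu hxu ha

end ParentMap

/-- The iterates of a self-embedding. -/
def iterateEmb {T : SimpleGraph V} (g : TreeEmb T T) (n : ℕ) : TreeEmb T T :=
  ⟨⟨g^[n], fun {v w} hvw => by
    induction n with
    | zero => exact hvw
    | succ n ih =>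
      rw [iterate_succ_apply', iterate_succ_apply']
      exact g.toHom.map_adj ih⟩, g.injective.iterate n⟩

theorem isElliptic_of_fixed {T : SimpleGraph V} {g : TreeEmb T T} {v : V} (hv : g v = v) :
    IsElliptic g := by
  refine ⟨T.singletonSubgraph v, ?_, Set.finite_singleton v, ?_⟩
  · have : Subsingleton (T.singletonSubgraph v).verts :=
      inferInstanceAs (Subsingleton ({v} : Set V))
    have : Nonempty (T.singletonSubgraph v).verts := ⟨⟨v, rfl⟩⟩
    exact ⟨⟨SimpleGraph.Preconnected.of_subsingleton⟩, SimpleGraph.IsAcyclic.of_subsingleton⟩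
  · refine SimpleGraph.Subgraph.ext ?_ ?_
    · change g '' {v} = {v}
      rw [Set.image_singleton, hv]
    · ext a b
      simp

/-- A parabolic embedding translates a ray towards its fixed end, and for every vertex of that ray
some iterate of the embedding misses it. -/
theorem IsParabolic.exists_translated_ray {T : SimpleGraph V} (hT : T.IsTree) {g : TreeEmb T T}
    (hg : IsParabolic g) : ∃ (π : V → V) (x : ℕ → V) (k : ℕ), ParentMap T π x ∧ 0 < k ∧
      (∀ i, g (x i) = x (i + k)) ∧ ∀ i, ∃ n, ∀ v, g^[n] v ≠ x i := by
  obtain ⟨hell, η, hη, huniq⟩ := hg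
  obtain ⟨R, rfl⟩ := Quot.exists_rep η
  obtain ⟨m, n, hmn⟩ := (rayEquiv_iff hT.isAcyclic _ _).1 (rayEquiv_of_mk_eq hT.isAcyclic hη)
  replace hmn : ∀ j, g (R (m + j)) = R (n + j) := hmn
  obtain ⟨π, h⟩ := exists_parentMap hT R
  have hcomm : ∀ v, g (π v) = π (g v) := h.commute_of_eventually h g (N := m) fun i hi => by
    obtain ⟨j, rfl⟩ := Nat.exists_eq_add_of_le hi
    rw [h.map_ray, hmn, h.map_ray, add_assoc, hmn, add_assoc]
  have hit : ∀ a l v, g^[l] (π^[a] v) = π^[a] (g^[l] v) := fun a l v =>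
    ((Function.Commute.iterate_iterate (f := g) (g := π) hcomm l a) v)
  rcases lt_trichotomy n m with hlt | rfl | hlt
  · -- A translation away from the fixed end produces a second fixed end.
    obtain ⟨k, rfl⟩ := Nat.exists_eq_add_of_lt hlt
    refine (h.false_of_descending hT hcomm huniq (k := k) (y := fun j => g^[j] (R (n + k + 1)))
      (fun j => ?_) (.inl fun j => (iterate_succ_apply' g j _).symm)).elim
    rw [iterate_succ_apply g, ← hit]
    congr 1
    have := hmn 0
    rw [add_zero, add_zero] at this
    rw [this, h.iterate_ray, add_assoc]
  · exact (hell (isElliptic_of_fixed (hmn 0))).elim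
  · obtain ⟨k, rfl⟩ := Nat.exists_eq_add_of_lt hlt
    have hk : ∀ i, g (R (m + i)) = R (m + (i + (k + 1))) := fun i => by
      rw [hmn]
      congr 1
      omega
    refine ⟨π, fun i => R (m + i), k + 1, h.shift m, k.succ_pos, hk, fun i => ?_⟩
    -- The preimages of a vertex in the range of all iterates descend towards a second fixed end.
    by_contra! hall
    choose y hy using hall
    refine h.false_of_descending hT hcomm huniq (k := k) (y := y) (fun j => ?_)
      (.inr fun j => g.injective.iterate j ?_)
    · refine g.injective.iterate (j + 1) ?_
      change g^[j + 1] _ = g^[j + 1] _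
      rw [hit, hy, iterate_succ_apply' g, hy, hk, h.iterate_ray, add_assoc]
    · change g^[j] _ = g^[j] _
      rw [← iterate_succ_apply, hy, hy]

end TreeSiblings


/-- Let `T` be a locally finite tree with a parabolic embedding. Then, unless `T` is a ray, `T` has
infinitely many siblings up to isomorphism. -/
theorem mainTheorem1 {V : Type*} (T : SimpleGraph V) [T.LocallyFinite] (hT : T.IsTree)
    (hpar : ∃ f : TreeSiblings.TreeEmb T T, TreeSiblings.IsParabolic f)
    (hray : ¬ TreeSiblings.IsRay T) :
    Cardinal.aleph0 ≤ TreeSiblings.sib T := by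
  open TreeSiblings Function in
  obtain ⟨g, hg⟩ := hpar
  obtain ⟨π, x, k, h, hkpos, hk, hmiss⟩ := hg.exists_translated_ray hT
  have hcomm : ∀ v, g (π v) = π (g v) := h.commute_of_eventually h g (N := 0) fun i _ => by
    rw [h.map_ray, hk, hk, h.map_ray, add_right_comm]
  have hit : ∀ a l v, g^[l] (π^[a] v) = π^[a] (g^[l] v) := fun a l v =>
    (Function.Commute.iterate_iterate (f := g) (g := π) hcomm l a) v
  have hkit : ∀ l i, g^[l] (x i) = x (i + l * k) := by
    intro l
    induction l with
    | zero => simp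
    | succ l ih =>
      intro i
      rw [iterate_succ_apply', ih, hk]
      congr 1
      ring
  have hbelow : ∀ m, ∃ n, ∀ v, g^[n] v ∉ descendants π (x m) := by
    intro m
    obtain ⟨n, hn⟩ := hmiss m
    refine ⟨n, ?_⟩
    rintro v ⟨a, ha⟩
    rw [← hit] at ha
    exact hn _ ha
  have hbranch : ∀ N, ∃ m, N ≤ m ∧ ∃ c, π c = x (m + 1) ∧ c ≠ x m := by
    intro N
    have hinj : ¬ Injective π := by
      intro hinj
      refine hray ?_
      by_cases hsurj : Surjective π
      · -- If `π` is bijective, then `x 0` has preimages under all iterates of `g`.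
        obtain ⟨n, hn⟩ := hmiss 0
        obtain ⟨z, hz⟩ := hsurj.iterate (n * k) (x 0)
        refine absurd (hinj.iterate (n * k) ?_) (hn z)
        rw [← hit, hz, hkit, h.iterate_ray]
      · simp only [Surjective, not_forall, not_exists] at hsurj
        obtain ⟨w, hw⟩ := hsurj
        exact h.isRay_of_injective hinj hw
    simp only [Injective, not_forall] at hinj
    obtain ⟨u, w, huw, hne⟩ := hinj
    obtain ⟨n, hn⟩ := hbelow N
    refine h.exists_branch (hn u) (hn w) (fun e => hne (g.injective.iterate n e)) ?_
    rw [← iterate_one π, ← hit, ← hit]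
    exact congrArg g^[n] huw
  have := h.infinite_siblings hT g hkpos hk hbranch fun m => by
    obtain ⟨n, hn⟩ := hbelow m
    exact ⟨iterateEmb g n, n * k, hkit n, hn⟩
  exact Cardinal.aleph0_le_mk _
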